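/- Theorem. Let $0\le k\le n$ be integers, and let $\mathsf{U}_{k,n}$ be the uniform matroid of rank $k$ on $n$ elements, whose bases are all $k$-element subsets of $\{1,\dots,n\}$. For a matroid $\mathsf{M}$ let $\mathcal{L}(\mathsf{M})$ be its lattice of flats, and for a flat $F$ let $\mathsf{M}_F$ be the contraction by $F$ and $\mathsf{M}^F$ the restriction to $F$. Let $\chi_{\mathsf{M}}$ be the characteristic polynomial of $\mathcal{L}(\mathsf{M})$ (with $\chi_{\mathsf{M}}=0$ if $\mathsf{M}$ has a loop). Let $P_{\mathsf{M}}(t)\in\mathbb{Z}[t]$ be the Kazhdan--Lusztig polynomial, i.e. the unique assignment such that (1) if $\operatorname{rk}(\mathsf{M})=0$ then $P_{\mathsf{M}}=1$ when $\mathsf{M}$ is empty and $P_{\mathsf{M}}=0$ otherwise; (2) if $\operatorname{rk}(\mathsf{M})>0$ then $\deg P_{\mathsf{M}}<\operatorname{rk}(\mathsf{M})/2$; (3) $t^{\operatorname{rk}(\mathsf{M})}P_{\mathsf{M}}(t^{-1})=\sum_{F\in\mathcal{L}(\mathsf{M})}\chi_{\mathsf{M}^F}(t)\,P_{\mathsf{M}_F}(t)$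 for every $\mathsf{M}$. Let $Z_{\mathsf{M}}(t)=\sum_{F\in\mathcal{L}(\mathsf{M})}t^{\operatorname{rk}(F)}P_{\mathsf{M}_F}(t)$. This is a palindromic polynomial of degree $d=\operatorname{rk}(\mathsf{M})$, and the $\gamma$-polynomial of $\mathsf{M}$ is the polynomial $\gamma_{\mathsf{M}}(t)=\sum_{i=0}^{\lfloor d/2\rfloor}\gamma_i t^i\in\mathbb{Z}[t]$ determined by $$Z_{\mathsf{M}}(t)=\sum_{i=0}^{\lfloor d/2\rfloor}\gamma_i\,t^i(1+t)^{d-2i}.$$ Then $\mathsf{U}_{k,n}$ is $\gamma$-positive, i.e. all coefficients of $\gamma_{\mathsf{U}_{k,n}}(t)$ are non-negative. Moreover $\gamma_{\mathsf{U}_{k,n}}$ has degree at most $\lfloor k/2\rfloor$, its constant term is $1$, and for every integer $i$ with $0<i<k$ its $i$-th coefficient is $$[t^i]\gamma_{\mathsf{U}_{k,n}}(t)=\frac{1}{k-i}\binom{k-i}{i}\sum_{j=i}^{k-1}(k-j)\binom{j-1}{i-1}\binom{n-k+j-1}{j}.$$ -/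

import Mathlib

open Polynomial

namespace Matroid

section Invariants

variable {α : Type*} [Finite α]

/-- The flats of `M`, partially ordered by inclusion. -/
abbrev Flats (M : Matroid α) : Type _ := {F : Set α // M.IsFlat F}

noncomputable instance (M : Matroid α) : Fintype (Flats M) := Fintype.ofFinite _

open Classical in
noncomputable instance (M : Matroid α) : LocallyFiniteOrder (Flats M) :=
  Fintype.toLocallyFiniteOrder

/-- The rank of a set, as a natural number. -/
noncomputable def rkSet (M : Matroid α) (A : Set α) : ℕ := (M.eRk A).toNat

/-- The rank of a matroid, as a natural number. -/
noncomputable def rkTop (M : Matroid α) : ℕ := M.rkSet M.E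

/-- The smallest flat, i.e. the flat spanned by the empty set. -/
def botFlat (M : Matroid α) : Flats M := ⟨M.closure ∅, M.isFlat_closure ∅⟩

open Classical in
/-- The characteristic polynomial of the lattice of flats,
`χ_M(t) = ∑_F μ(⊥, F) t ^ (rk M - rk F)`, with the usual convention that it is `0` when `M` has
loops. -/
noncomputable def charPoly (M : Matroid α) : ℤ[X] :=
  if M.Loopless then
    ∑ F : Flats M, C (IncidenceAlgebra.mu ℤ M.botFlat F) * X ^ (M.rkTop - M.rkSet F.1)
  else 0

/-- The three conditions that characterize the Kazhdan-Lusztig polynomials of matroids. Here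
`reflect r p` is `t ^ r * p(t⁻¹)`, the contraction `M ／ F` is `M_F` and the restriction `M ↾ F`
is the localization `M^F`. -/
structure IsKazhdanLusztig (P : Matroid α → ℤ[X]) : Prop where
  rank_zero : ∀ M : Matroid α, M.rkTop = 0 → (M.E = ∅ → P M = 1) ∧ (M.E ≠ ∅ → P M = 0)
  degree_lt : ∀ M : Matroid α, 0 < M.rkTop → 2 * (P M).natDegree < M.rkTop
  reciprocity : ∀ M : Matroid α,
    reflect M.rkTop (P M) = ∑ F : Flats M, charPoly (M ↾ F.1) * P (M ／ F.1)

lemma ncard_contract_ground_lt (M : Matroid α) {F : Set α} (hF : M.IsFlat F) (hne : F ≠ ∅) :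
    (M ／ F).E.ncard < M.E.ncard := by
  obtain ⟨x, hx⟩ := Set.nonempty_iff_ne_empty.2 hne
  refine Set.ncard_lt_ncard ⟨Set.sdiff_subset, fun h => ?_⟩ (Set.toFinite _)
  exact (h (hF.subset_ground hx)).2 hx

open Classical in
/-- The Kazhdan-Lusztig polynomial `P_M` of a matroid, computed by recursion on the ground set.
In positive rank `r`, since `P_M` has degree `< r / 2`, its coefficient of `t ^ i` with `i < r / 2`
is the coefficient of `t ^ (r - i)` in `t ^ r * P_M(t⁻¹) - P_M(t)`, and the reciprocity condition
gives this difference as the sum of `χ_{M^F} * P_{M_F}` over the non-empty flats `F`.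
See `IsKazhdanLusztig.eq_klPoly`. -/
noncomputable def klPoly (M : Matroid α) : ℤ[X] :=
  if M.rkTop = 0 then (if M.E = ∅ then 1 else 0)
  else
    ∑ i ∈ Finset.range ((M.rkTop + 1) / 2),
      C ((∑ F : {F : Flats M // F.1 ≠ ∅},
        charPoly (M ↾ F.1.1) * klPoly (M ／ F.1.1)).coeff (M.rkTop - i)) * X ^ i
termination_by M.E.ncard
decreasing_by exact M.ncard_contract_ground_lt F.1.2 F.2

/-- The Kazhdan-Lusztig polynomials are the only ones that satisfy the three conditions. -/
theorem IsKazhdanLusztig.eq_klPoly {P : Matroid α → ℤ[X]} (hP : IsKazhdanLusztig P)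
    (M : Matroid α) : P M = klPoly M := by
  classical
  induction hn : M.E.ncard using Nat.strong_induction_on generalizing M with
  | _ n ih =>
  rw [klPoly]
  split_ifs with h0 hE
  · exact (hP.rank_zero M h0).1 hE
  · exact (hP.rank_zero M h0).2 hE
  have hpos : 0 < M.rkTop := Nat.pos_of_ne_zero h0
  have hdeg := hP.degree_lt M hpos
  have hS : (∑ F : {F : Flats M // F.1 ≠ ∅}, charPoly (M ↾ F.1.1) * klPoly (M ／ F.1.1))
      = ∑ F : {F : Flats M // F.1 ≠ ∅}, charPoly (M ↾ F.1.1) * P (M ／ F.1.1) := by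
    refine Finset.sum_congr rfl fun F _ => ?_
    rw [ih _ (hn ▸ M.ncard_contract_ground_lt F.1.2 F.2) _ rfl]
  rw [hS]
  have hrec := hP.reciprocity M
  rw [← Fintype.sum_subtype_add_sum_subtype (fun F : Flats M => F.1 ≠ ∅)] at hrec
  have hlow : ∀ m, M.rkTop ≤ 2 * m → (∑ F : {F : Flats M // ¬ F.1 ≠ ∅},
      charPoly (M ↾ F.1.1) * P (M ／ F.1.1)).coeff m = 0 := by
    intro m hm
    rw [finsetSum_coeff]
    refine Finset.sum_eq_zero fun F _ => ?_
    have hF : F.1.1 = ∅ := not_not.1 F.2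
    have hr : ∀ A, (M ↾ (∅ : Set α)).rkSet A = 0 := by
      intro A
      have : (M ↾ (∅ : Set α)).eRk A ≤ (M ↾ (∅ : Set α)).eRank := eRk_le_eRank _ _
      simp at this
      simp [rkSet, this]
    have hd : (charPoly (M ↾ (∅ : Set α))).natDegree = 0 := by
      rw [charPoly]
      split_ifs
      · rw [← Nat.le_zero]
        refine natDegree_sum_le_of_forall_le _ _ fun F _ => ?_
        rw [show (M ↾ (∅ : Set α)).rkTop = 0 from hr _, Nat.zero_sub, pow_zero, mul_one, natDegree_C]
      · simp
    rw [hF, contract_empty]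
    refine coeff_eq_zero_of_natDegree_lt (natDegree_mul_le.trans_lt ?_)
    omega
  ext i
  simp only [finsetSum_coeff, coeff_C_mul, coeff_X_pow, mul_ite, mul_one, mul_zero,
    Finset.sum_ite_eq, Finset.mem_range]
  split_ifs with hi
  · have := congrArg (fun p => p.coeff (M.rkTop - i)) hrec
    simp only [coeff_add, coeff_reflect] at this
    rw [hlow _ (by omega), revAt_le (by omega), add_zero,
      show M.rkTop - (M.rkTop - i) = i by omega] at this
    rw [this, finsetSum_coeff]
  · exact coeff_eq_zero_of_natDegree_lt (by omega)

/-- The `Z`-polynomial `Z_M(t) = ∑_F t ^ (rk F) * P_{M_F}(t)`. -/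
noncomputable def zPoly (M : Matroid α) : ℤ[X] :=
  ∑ F : Flats M, X ^ M.rkSet F.1 * klPoly (M ／ F.1)

end Invariants

/-- `g = ∑ γ_i t ^ i` gives the expansion
`f = ∑_{i ≤ d / 2} γ_i t ^ i (1 + t) ^ (d - 2 i)`, where `d` is the degree of `f`. -/
def IsGammaExpansion (f g : ℤ[X]) : Prop :=
  g.natDegree ≤ f.natDegree / 2 ∧
    f = ∑ i ∈ Finset.range (f.natDegree / 2 + 1),
      C (g.coeff i) * X ^ i * (1 + X) ^ (f.natDegree - 2 * i)

open Classical in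
/-- The `γ`-polynomial `γ(f, t)` of a palindromic polynomial `f` (and `0` if `f` is not
palindromic, in which case it has no such expansion). -/
noncomputable def gammaOf (f : ℤ[X]) : ℤ[X] :=
  if h : ∃ g, IsGammaExpansion f g then h.choose else 0

/-- The `γ`-polynomial of a matroid. -/
noncomputable def gammaPoly {α : Type*} [Finite α] (M : Matroid α) : ℤ[X] := gammaOf M.zPoly

/-- A matroid is `γ`-positive if its `γ`-polynomial has non-negative coefficients. -/
def IsGammaPositive {α : Type*} [Finite α] (M : Matroid α) : Prop :=
  ∀ i, 0 ≤ M.gammaPoly.coeff i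

/-- The uniform matroid `U_{k,n}` on `n` elements: a set is independent if it has at most `k`
elements. -/
noncomputable def uniform (k n : ℕ) : Matroid (Fin n) :=
  (IndepMatroid.ofFinite (E := Set.univ) Set.finite_univ (fun I => I.ncard ≤ k)
    (by simp)
    (fun _ _ hJ hIJ => (Set.ncard_le_ncard hIJ (Set.toFinite _)).trans hJ)
    (fun I J _ hJ hIJ => by
      obtain ⟨e, heJ, heI⟩ := Set.exists_mem_notMem_of_ncard_lt_ncard hIJ (Set.toFinite _)
      refine ⟨e, heJ, heI, ?_⟩
      rw [Set.ncard_insert_of_notMem heI (Set.toFinite _)]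
      omega)
    (fun _ _ => Set.subset_univ _)).matroid

/-- The bases of `U_{k,n}` are the `k`-element subsets. -/
theorem uniform_isBase_iff {k n : ℕ} (hkn : k ≤ n) (B : Set (Fin n)) :
    (uniform k n).IsBase B ↔ B.ncard = k := by
  have hind : ∀ I, (uniform k n).Indep I ↔ I.ncard ≤ k := fun I => Iff.rfl
  rw [isBase_iff_maximal_indep, maximal_iff]
  simp only [hind]
  constructor
  · rintro ⟨hB, hmax⟩
    by_contra hne
    obtain ⟨C, hBC, -, hC⟩ := Set.exists_subsuperset_card_eq (n := k) (Set.subset_univ B) hB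
      (by simpa [Set.ncard_univ] using hkn)
    exact hne (by rw [hmax hC.le hBC, hC])
  · intro hB
    exact ⟨hB.le, fun C hC hBC => Set.eq_of_subset_of_ncard_le hBC (by omega) (Set.toFinite _)⟩

end Matroid

/-! Write P(d, m) and Z(d, m) for the Kazhdan-Lusztig and Z-polynomials in rank `d` and corank `m`.
A proper flat is a set of fewer than `d` elements; restriction to it is Boolean and contraction by
it keeps the corank. Hence sums over flats become `binTransform`s with `m` fixed, and these compose
additively in `x`.

The candidates `uniformKL` satisfy P(d, m+1) = P(d, m) - t P(d-1, m+1) + defect. In Z the middle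
term cancels by Pascal's rule, and each term of the defect becomes a non-negative multiple of some
t^i (1+t)^(d-2i) (`binTransform_klDefect`, `klTop_nonneg`). Since Z(d, 0) = (1+t)^d, induction on
`m` gives the γ-expansion `uniformZ_eq`, with non-negative coefficients.

The candidates are the true polynomials: the expansion makes Z palindromic, inverting the transform
turns this into reciprocity (`reflect_uniformKL`), and a closed form of the coefficients
(`mul_uniformKL_coeff`) gives the degree bound. The formula for γ_i is a further induction on `m`
(`mul_uniformGamma`). -/

namespace Matroid

/-! ### Binomial transforms. -/

section BinomialTransform

variable {R : Type*} [CommRing R]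

/-- The transform `a ↦ (d ↦ ∑_{j < d} binom (m + d) j * x ^ j * a (d - j))`. -/
def binTransform (m : ℕ) (x : R) (a : ℕ → R) (d : ℕ) : R :=
  ∑ j ∈ Finset.range d, ((m + d).choose j : R) * x ^ j * a (d - j)

lemma binTransform_add (m : ℕ) (x : R) (a b : ℕ → R) (d : ℕ) :
    binTransform m x (fun e => a e + b e) d = binTransform m x a d + binTransform m x b d := by
  simp [binTransform, mul_add, Finset.sum_add_distrib]

lemma binTransform_congr {m : ℕ} {x : R} {a b : ℕ → R} {d : ℕ}
    (h : ∀ e, 0 < e → e ≤ d → a e = b e) : binTransform m x a d = binTransform m x b d := by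
  refine Finset.sum_congr rfl fun j hj => ?_
  rw [h _ (by have := Finset.mem_range.1 hj; omega) (by omega)]

/-- Terms are grouped by the total shift `s`; trinomial revision and the binomial theorem for `(x +
y) ^ s` finish. In positive degrees the transform for `-x` therefore inverts the one for `x`. -/
lemma binTransform_binTransform (m : ℕ) (x y : R) (a : ℕ → R) (d : ℕ) :
    binTransform m x (binTransform m y a) d = binTransform m (x + y) a d := by
  simp only [binTransform, Finset.mul_sum]
  rw [Finset.sum_sigma']
  have : ∀ s ∈ Finset.range d, ((m + d).choose s : R) * (x + y) ^ s * a (d - s) =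
      ∑ j ∈ Finset.range (s + 1), ((m + d).choose s : R) * (x ^ j * y ^ (s - j) * (s.choose j : R))
        * a (d - s) := by
    intro s _
    rw [add_pow, Finset.mul_sum, Finset.sum_mul]
  rw [Finset.sum_congr rfl this, Finset.sum_sigma']
  refine Finset.sum_bij' (fun p _ => ⟨p.1 + p.2, p.1⟩) (fun p _ => ⟨p.2, p.1 - p.2⟩) ?_ ?_ ?_ ?_ ?_
  · rintro ⟨j, i⟩ h
    simp only [Finset.mem_sigma, Finset.mem_range] at h ⊢
    omega
  · rintro ⟨s, j⟩ h
    simp only [Finset.mem_sigma, Finset.mem_range] at h ⊢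
    omega
  · rintro ⟨j, i⟩ h
    simp
  · rintro ⟨s, j⟩ h
    simp only [Finset.mem_sigma, Finset.mem_range] at h
    simp only [Sigma.mk.injEq, heq_eq_eq, and_true]
    omega
  · rintro ⟨j, i⟩ h
    simp only [Finset.mem_sigma, Finset.mem_range] at h
    have hc := Nat.choose_mul (n := m + d) (k := j + i) (s := j) (by omega)
    rw [show j + i - j = i by omega, show m + d - j = m + (d - j) by omega] at hc
    have hc' : ((m + d).choose (j + i) : R) * ((j + i).choose j : R) =
        ((m + d).choose j : R) * ((m + (d - j)).choose i : R) := by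
      exact_mod_cast congrArg (Nat.cast (R := R)) hc
    simp only [show j + i - j = i by omega, Nat.sub_sub]
    linear_combination (-(x ^ j * y ^ i * a (d - (j + i)))) * hc'

lemma binTransform_zero (m : ℕ) (a : ℕ → R) {d : ℕ} (hd : 0 < d) :
    binTransform m 0 a d = a d := by
  rw [binTransform, Finset.sum_eq_single_of_mem 0 (by simpa using hd)]
  · simp
  · intro j _ hj
    simp [hj]

lemma binTransform_neg_one_boolean (x : R) {d : ℕ} (hd : 0 < d) :
    binTransform 0 (-1) (fun e => x ^ e - 1) d = (x - 1) ^ d := by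
  have h : binTransform 0 (-1) (fun e => x ^ e - 1) d =
      ∑ j ∈ Finset.range (d + 1), (d.choose j : R) * (-1) ^ j * (x ^ (d - j) - 1) := by
    rw [Finset.sum_range_succ]
    simp [binTransform]
  have h1 := add_pow (-1) x d
  have h2 := add_pow (-1) (1 : R) d
  rw [neg_add_cancel, zero_pow hd.ne'] at h2
  rw [h, sub_eq_neg_add, h1, ← sub_zero (∑ m ∈ _, (-1) ^ m * x ^ (d - m) * _), h2,
    ← Finset.sum_sub_distrib]
  refine Finset.sum_congr rfl fun j _ => ?_
  ring

end BinomialTransform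

/-! ### Candidate Kazhdan-Lusztig polynomials. -/

section Uniform

/-- The top coefficient of the Kazhdan-Lusztig polynomial of the uniform matroid of rank `2 p + 1`
and corank `m + 1`, see `succ_mul_klTop`. -/
def klTop (p m : ℕ) : ℤ :=
  (2 * p + m + 2).choose (p + 1) * (p + m).choose p -
    (2 * p + m + 2).choose p * (p + m + 1).choose (p + 1)

/-- The product form makes the positivity of the difference `klTop` visible. -/
lemma succ_mul_klTop (p m : ℕ) :
    ((p : ℤ) + 1) * klTop p m = (2 * p + m + 2).choose p * (p + m).choose p := by
  have h1 := Nat.choose_succ_right_eq (2 * p + m + 2) p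
  have h2 := Nat.add_one_mul_choose_eq (p + m) p
  rw [show 2 * p + m + 2 - p = p + m + 2 by omega] at h1
  zify at h1 h2
  rw [klTop]
  linear_combination ((p + m).choose p : ℤ) * h1 + ((2 * p + m + 2).choose p : ℤ) * h2

lemma klTop_nonneg (p m : ℕ) : 0 ≤ klTop p m := by
  have h := succ_mul_klTop p m
  refine nonneg_of_mul_nonneg_right (a := (p : ℤ) + 1) ?_ (by positivity)
  rw [h]
  positivity

/-- The term by which the deletion formula for uniform matroids deviates from the recursion
`P_{d, m + 1} = P_{d, m} - t P_{d - 1, m + 1}`. -/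
noncomputable def klDefect (d m : ℕ) : ℤ[X] :=
  ∑ p ∈ Finset.range d, C (((d + m).choose (m + 2 * p + 2) : ℤ) * klTop p m) * X ^ (p + 1)

/-- The Kazhdan-Lusztig polynomial of the uniform matroid of rank `d` and corank `m`,
for positive `d`, by deletion. -/
noncomputable def uniformKL : ℕ → ℕ → ℤ[X]
  | 0, _ => 0
  | _ + 1, 0 => 1
  | d + 1, m + 1 => uniformKL (d + 1) m - X * uniformKL d (m + 1) + klDefect (d + 1) m

lemma uniformKL_succ (d m : ℕ) :
    uniformKL d (m + 1) = uniformKL d m - X * uniformKL (d - 1) (m + 1) + klDefect d m := by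
  cases d with
  | zero => simp [uniformKL, klDefect]
  | succ d => simp [uniformKL]

lemma klDefect_coeff_zero (d m : ℕ) : (klDefect d m).coeff 0 = 0 := by
  simp [klDefect, coeff_X_pow]

lemma klDefect_coeff_succ (d m p : ℕ) :
    (klDefect d m).coeff (p + 1) = ((d + m).choose (m + 2 * p + 2) : ℤ) * klTop p m := by
  simp only [klDefect, finsetSum_coeff, coeff_C_mul, coeff_X_pow, add_left_inj, mul_ite, mul_one,
    mul_zero, Finset.sum_ite_eq, Finset.mem_range]
  split_ifs with h
  · rfl
  · rw [Nat.choose_eq_zero_of_lt (by omega)]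
    simp

lemma uniformKL_coeff_zero (d m : ℕ) : (uniformKL (d + 1) m).coeff 0 = 1 := by
  induction m with
  | zero => simp [uniformKL]
  | succ m ih => simp [uniformKL, ih, klDefect_coeff_zero]

lemma uniformKL_coeff_of_le (d m i : ℕ) (h : d ≤ i) : (uniformKL d m).coeff i = 0 := by
  induction d generalizing m i with
  | zero => simp [uniformKL]
  | succ d ihd =>
    obtain ⟨i, rfl⟩ : ∃ p, i = p + 1 := ⟨i - 1, by omega⟩
    induction m with
    | zero => simp [uniformKL, coeff_one]
    | succ m ihm =>
      rw [uniformKL, coeff_add, coeff_sub, ihm, coeff_X_mul, ihd _ _ (by omega),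
        klDefect_coeff_succ, Nat.choose_eq_zero_of_lt (by omega)]
      simp

/-! ### Closed form of the coefficients and the degree bound. -/

lemma sum_choose_telescope (a p m : ℕ) :
    (∑ h ∈ Finset.range (m + 1), (a + h).choose (h + p + 2) * (p + h).choose h) +
      ∑ h ∈ Finset.range (m + 1), (a + h).choose (h + p + 1) * (p + h - 1).choose h =
    (p + m).choose p * (a + m + 1).choose (m + p + 2) := by
  induction m with
  | zero => simp [Nat.choose_succ_succ' a (p + 1), add_comm, add_left_comm]
  | succ m ih =>
    rw [Finset.sum_range_succ, Finset.sum_range_succ _ (m + 1), add_add_add_comm, ih]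
    have e1 : (p + (m + 1)).choose (m + 1) = (p + m).choose p + (p + m).choose (m + 1) := by
      rw [Nat.choose_symm_add (a := p) (b := m), ← Nat.choose_succ_succ']
      rfl
    have e2 : (p + (m + 1)).choose p = (p + (m + 1)).choose (m + 1) := Nat.choose_symm_add
    have e3 : (a + (m + 1) + 1).choose (m + 1 + p + 2) =
        (a + m + 1).choose (m + p + 2) + (a + m + 1).choose (m + p + 3) := by
      rw [show m + 1 + p + 2 = m + p + 2 + 1 by omega]
      exact Nat.choose_succ_succ' _ _
    rw [e2, e1, e3, show m + 1 + p + 2 = m + p + 3 by omega, show m + 1 + p + 1 = m + p + 2 by omega,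
      show p + (m + 1) - 1 = p + m by omega, ← add_assoc a m 1]
    ring

/-- Splits a defect coefficient into the new summand `h = m` of the closed form and a term that
`sum_choose_telescope` expands into two sums. -/
lemma choose_mul_klTop (a p m : ℕ) :
    (a : ℤ) * ((a + p + 1 + m).choose (m + 2 * p + 2) * klTop p m) =
      (a + p + 1 + m).choose (p + 1) * ((a + m).choose (m + p + 2) * (p + m).choose m) +
      (a + p + 1 + m).choose p * ((p + m).choose p * (a + m + 1).choose (m + p + 2)) := by
  have hp : ((p : ℤ) + 1) ≠ 0 := by positivity
  refine mul_left_cancel₀ hp ?_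
  have h1 := succ_mul_klTop p m
  have h2 := Nat.choose_mul (n := a + p + 1 + m) (k := m + 2 * p + 2) (s := p) (by omega)
  have h3 := Nat.choose_succ_right_eq (a + p + 1 + m) p
  have h4 := Nat.choose_mul_succ_eq (a + m) (m + p + 2)
  have h5 : (p + m).choose m = (p + m).choose p := Nat.choose_symm_add.symm
  rw [show a + p + 1 + m - p = a + m + 1 by omega] at h2 h3
  rw [show m + 2 * p + 2 - p = m + p + 2 by omega, show m + 2 * p + 2 = 2 * p + m + 2 by omega] at h2
  rw [h5, show m + 2 * p + 2 = 2 * p + m + 2 by omega]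
  have h4' : ((a + m).choose (m + p + 2) : ℤ) * (a + m + 1) =
      (a + m + 1).choose (m + p + 2) * (a - p - 1) := by
    rcases Nat.lt_or_ge (a + m + 1) (m + p + 2) with h | h
    · rw [Nat.choose_eq_zero_of_lt h, Nat.choose_eq_zero_of_lt (by omega)]
      simp
    · zify [h] at h4
      linear_combination h4
  zify at h2 h3
  linear_combination (a : ℤ) * ((a + p + 1 + m).choose (2 * p + m + 2) : ℤ) * h1 +
    (a : ℤ) * ((p + m).choose p : ℤ) * h2 -
    ((a + m).choose (m + p + 2) : ℤ) * ((p + m).choose p : ℤ) * h3 -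
    ((a + p + 1 + m).choose p : ℤ) * ((p + m).choose p : ℤ) * h4'

/-- The closed form of the coefficients of `uniformKL`. -/
lemma mul_uniformKL_coeff (a i m : ℕ) (ha : 0 < a) :
    (a : ℤ) * (uniformKL (a + i) (m + 1)).coeff i = (a + i + (m + 1)).choose i *
      ∑ h ∈ Finset.range (m + 1), ((a + h).choose (h + i + 1) * (i + h - 1).choose h : ℕ) := by
  induction i generalizing m with
  | zero =>
    obtain ⟨a, rfl⟩ : ∃ b, a = b + 1 := ⟨a - 1, by omega⟩
    -- Truncated subtraction gives `0 + h - 1 < h` for `h > 0`, and the value 1 at `h = 0`.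
    rw [add_zero, uniformKL_coeff_zero, Finset.sum_eq_single_of_mem 0 (by simp)]
    · simp
    · intro h _ hh
      rw [Nat.choose_eq_zero_of_lt (n := 0 + h - 1) (by omega)]
      simp
  | succ p ihp =>
    have hP : ∀ m, (a + (p + 1) + (m + 1)).choose (p + 1) =
        (a + p + 1 + m).choose p + (a + p + 1 + m).choose (p + 1) := fun m =>
      Nat.choose_succ_succ' _ _
    -- The sum subtracted here comes from `ihp` and cancels the last one, from
    -- `sum_choose_telescope`; Pascal's rule `hP` assembles the rest.
    have key : ∀ m, (a : ℤ) * (uniformKL (a + (p + 1)) (m + 1)).coeff (p + 1) =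
        a * (uniformKL (a + (p + 1)) m).coeff (p + 1) -
        (a + p + 1 + m).choose p * ∑ h ∈ Finset.range (m + 1),
          ((a + h).choose (h + p + 1) * (p + h - 1).choose h : ℕ) +
        ((a + p + 1 + m).choose (p + 1) * ((a + m).choose (m + p + 2) * (p + m).choose m) +
      (a + p + 1 + m).choose p * ((∑ h ∈ Finset.range (m + 1),
          ((a + h).choose (h + p + 2) * (p + h).choose h : ℕ)) + ∑ h ∈ Finset.range (m + 1),
          ((a + h).choose (h + p + 1) * (p + h - 1).choose h : ℕ))) := by
      intro m
      have ht := sum_choose_telescope a p m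
      zify at ht
      push_cast at ht ⊢
      rw [ht, ← choose_mul_klTop, uniformKL_succ, coeff_add, coeff_sub, coeff_X_mul,
        klDefect_coeff_succ]
      have := ihp m
      push_cast at this
      rw [show a + (p + 1) - 1 = a + p by omega, mul_add, mul_sub, this,
        show a + p + (m + 1) = a + p + 1 + m by omega, ← add_assoc a p 1]
    induction m with
    | zero =>
      have h0 : (uniformKL (a + (p + 1)) 0).coeff (p + 1) = 0 := by
        rw [← add_assoc, uniformKL, coeff_one]
        simp
      rw [key, h0, hP]
      simp
      ring_nf
    | succ m ihm =>
      have hs {n : ℕ} : ∀ h ∈ Finset.range n, (a + h).choose (h + (p + 1) + 1) *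
          (p + 1 + h - 1).choose h = (a + h).choose (h + p + 2) * (p + h).choose h := by
        intro h _
        rw [show p + 1 + h - 1 = p + h by omega, show h + (p + 1) + 1 = h + p + 2 by omega]
      rw [key, ihm, hP (m + 1), show a + (p + 1) + (m + 1) = a + p + 1 + (m + 1) by omega,
        Finset.sum_congr rfl hs, Finset.sum_congr rfl hs,
        Finset.sum_range_succ (fun h => (a + h).choose (h + p + 2) * (p + h).choose h) (m + 1)]
      push_cast
      ring

/-- With `d = a + i`, the hypothesis says `a ≤ i`, so every `(a + h).choose (h + i + 1)` in the
closed form vanishes. -/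
lemma uniformKL_coeff_eq_zero {d m i : ℕ} (hi : d ≤ 2 * i) : (uniformKL d m).coeff i = 0 := by
  rcases Nat.lt_or_ge i d with h | h
  · obtain ⟨a, rfl⟩ : ∃ a, d = a + i := ⟨d - i, by omega⟩
    cases m with
    | zero =>
      obtain ⟨e, he⟩ : ∃ e, a + i = e + 1 := ⟨a + i - 1, by omega⟩
      rw [he, uniformKL, coeff_one, if_neg (by omega)]
    | succ m =>
      have := mul_uniformKL_coeff a i m (by omega)
      rw [Finset.sum_eq_zero, Nat.cast_zero, mul_zero] at this
      · rcases mul_eq_zero.1 this with h0 | h0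
        · omega
        · exact h0
      · intro l _
        rw [Nat.choose_eq_zero_of_lt (by omega)]
        simp
  · exact uniformKL_coeff_of_le _ _ _ h

/-! ### The Z-polynomial and its γ-expansion. -/

/-- The `Z`-polynomial of the uniform matroid of rank `d` and corank `m`. -/
noncomputable def uniformZ (d m : ℕ) : ℤ[X] :=
  X ^ d + binTransform m X (fun e => uniformKL e m) d

/-- Choosing disjoint subsets of sizes `j` and `m + 2p + 2` among `d + m` elements can be done in
either order; this leaves `(d - 2(p + 1)).choose j`, which sums over `j` to a power of `1 + X`. -/
lemma binTransform_klDefect (d m : ℕ) :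
    binTransform m X (fun e => klDefect e m) d =
      ∑ p ∈ Finset.range (d / 2), C (((d + m).choose (m + 2 * p + 2) : ℤ) * klTop p m) *
        X ^ (p + 1) * (1 + X) ^ (d - 2 * (p + 1)) := by
  -- A range for `p` independent of `j` allows the sums to be exchanged; the terms gained or lost
  -- vanish.
  have h1 : binTransform m X (fun e => klDefect e m) d = ∑ j ∈ Finset.range d,
      ∑ p ∈ Finset.range (d / 2), ((m + d).choose j : ℤ[X]) * X ^ j *
        (C (((d - j + m).choose (m + 2 * p + 2) : ℤ) * klTop p m) * X ^ (p + 1)) := by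
    refine Finset.sum_congr rfl fun j hj => ?_
    rw [← Finset.mul_sum]
    congr 1
    ext i
    cases i with
    | zero => simp [klDefect, coeff_X_pow]
    | succ p =>
      rw [klDefect_coeff_succ]
      simp only [finsetSum_coeff, coeff_C_mul, coeff_X_pow, add_left_inj, mul_ite, mul_one,
        mul_zero, Finset.sum_ite_eq, Finset.mem_range]
      split_ifs with h
      · rfl
      · rw [Nat.choose_eq_zero_of_lt (by omega)]
        simp
  rw [h1, Finset.sum_comm]
  refine Finset.sum_congr rfl fun p hp => ?_
  have hp' := Finset.mem_range.1 hp
  have h2 : (1 + X : ℤ[X]) ^ (d - 2 * (p + 1)) =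
      ∑ j ∈ Finset.range d, X ^ j * ((d - 2 * (p + 1)).choose j : ℤ[X]) := by
    rw [add_comm, add_pow]
    simp only [one_pow, mul_one]
    refine Finset.sum_subset (Finset.range_subset_range.2 (by omega)) fun j _ hj => ?_
    rw [Nat.choose_eq_zero_of_lt (by simpa using hj)]
    simp
  rw [h2, Finset.mul_sum]
  refine Finset.sum_congr rfl fun j hj => ?_
  have hj' := Finset.mem_range.1 hj
  have h3 : (m + d).choose j * (d - j + m).choose (m + 2 * p + 2) =
      (d + m).choose (m + 2 * p + 2) * (d - 2 * (p + 1)).choose j := by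
    rcases Nat.lt_or_ge (d - 2 * (p + 1)) j with h | h
    · rw [Nat.choose_eq_zero_of_lt h, Nat.choose_eq_zero_of_lt (n := d - j + m) (by omega)]
      simp
    have e1 := Nat.choose_mul (n := d + m) (k := j + (m + 2 * p + 2)) (s := j) (by omega)
    have e2 := Nat.choose_mul (n := d + m) (k := j + (m + 2 * p + 2)) (s := m + 2 * p + 2) (by omega)
    rw [show d + m - j = d - j + m by omega, show j + (m + 2 * p + 2) - j = m + 2 * p + 2 by omega] at e1
    rw [← Nat.choose_symm_add, e1, show d + m - (m + 2 * p + 2) = d - 2 * (p + 1) by omega,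
      show j + (m + 2 * p + 2) - (m + 2 * p + 2) = j by omega] at e2
    rw [add_comm m d, e2]
  have h3' : ((m + d).choose j : ℤ[X]) * ((d - j + m).choose (m + 2 * p + 2) : ℤ[X]) =
      ((d + m).choose (m + 2 * p + 2) : ℤ[X]) * ((d - 2 * (p + 1)).choose j : ℤ[X]) := by
    exact_mod_cast congrArg (Nat.cast (R := ℤ[X])) h3
  simp only [map_mul, map_natCast]
  linear_combination (X ^ j * C (klTop p m) * X ^ (p + 1)) * h3'

/-- Pascal's rule on `(m + 1 + d).choose j` creates a shifted copy of the sum, which cancels the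
term `-X * P(d - 1, m + 1)` of the deletion recursion. -/
lemma uniformZ_succ (d m : ℕ) :
    uniformZ d (m + 1) = uniformZ d m +
      ∑ p ∈ Finset.range (d / 2), C (((d + m).choose (m + 2 * p + 2) : ℤ) * klTop p m) *
        X ^ (p + 1) * (1 + X) ^ (d - 2 * (p + 1)) := by
  rw [← binTransform_klDefect, uniformZ, uniformZ, add_assoc]
  congr 1
  cases d with
  | zero => simp [binTransform]
  | succ d =>
    have h1 : binTransform (m + 1) X (fun e => uniformKL e (m + 1)) (d + 1) =
        ∑ j ∈ Finset.range (d + 1), ((m + (d + 1)).choose j : ℤ[X]) * X ^ j *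
          uniformKL (d + 1 - j) (m + 1) +
        ∑ j ∈ Finset.range (d + 1), ((m + (d + 1)).choose j : ℤ[X]) * X ^ (j + 1) *
          uniformKL (d + 1 - (j + 1)) (m + 1) := by
      -- The last shifted term is zero thanks to the convention `uniformKL 0 _ = 0`.
      rw [Finset.sum_range_succ (fun j => ((m + (d + 1)).choose j : ℤ[X]) * X ^ (j + 1) *
        uniformKL (d + 1 - (j + 1)) (m + 1)) d, binTransform, Finset.sum_range_succ',
        Finset.sum_range_succ' _ d, Nat.sub_self, uniformKL, mul_zero, add_zero]
      refine Eq.trans ?_ (add_right_comm _ _ _)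
      rw [← Finset.sum_add_distrib]
      congr 1
      · refine Finset.sum_congr rfl fun j _ => ?_
        rw [show m + 1 + (d + 1) = m + (d + 1) + 1 by omega, Nat.choose_succ_succ']
        push_cast
        ring
    rw [h1, binTransform, binTransform, ← Finset.sum_add_distrib, ← Finset.sum_add_distrib]
    refine Finset.sum_congr rfl fun j _ => ?_
    rw [uniformKL_succ (d + 1 - j), Nat.sub_sub]
    ring

/-- The `γ`-polynomial of the uniform matroid of rank `d` and corank `m`, coefficientwise. -/
def uniformGamma (d m : ℕ) : ℕ → ℤ
  | 0 => 1
  | p + 1 => ∑ l ∈ Finset.range m, ((d + l).choose (l + 2 * p + 2) : ℤ) * klTop p l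

lemma uniformZ_zero (d : ℕ) : uniformZ d 0 = (1 + X) ^ d := by
  rw [uniformZ, add_comm 1 X, add_pow, Finset.sum_range_succ, add_comm]
  simp only [binTransform, one_pow, mul_one, Nat.choose_self, Nat.cast_one, zero_add]
  congr 1
  refine Finset.sum_congr rfl fun j hj => ?_
  have := Finset.mem_range.1 hj
  obtain ⟨e, he⟩ : ∃ e, d - j = e + 1 := ⟨d - j - 1, by omega⟩
  rw [he, uniformKL]
  ring

lemma uniformZ_eq (d m : ℕ) :
    uniformZ d m = ∑ i ∈ Finset.range (d / 2 + 1),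
      C (uniformGamma d m i) * X ^ i * (1 + X) ^ (d - 2 * i) := by
  rw [Finset.sum_range_succ']
  induction m with
  | zero => simp [uniformZ_zero, uniformGamma]
  | succ m ih =>
    rw [uniformZ_succ, ih, add_right_comm, ← Finset.sum_add_distrib]
    congr 1
    refine Finset.sum_congr rfl fun p _ => ?_
    rw [uniformGamma, uniformGamma, Finset.sum_range_succ, C_add]
    ring

lemma uniformGamma_nonneg (d m i : ℕ) : 0 ≤ uniformGamma d m i := by
  cases i with
  | zero => simp [uniformGamma]
  | succ p => exact Finset.sum_nonneg fun l _ => mul_nonneg (by positivity) (klTop_nonneg _ _)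

lemma uniformGamma_eq_zero {d m i : ℕ} (h : d < 2 * i) : uniformGamma d m i = 0 := by
  obtain ⟨p, rfl⟩ : ∃ p, i = p + 1 := ⟨i - 1, by omega⟩
  refine Finset.sum_eq_zero fun l _ => ?_
  rw [Nat.choose_eq_zero_of_lt (by omega)]
  simp

end Uniform
end Matroid

namespace Matroid

/-! ### Palindromicity and reciprocity. -/

section Uniform

lemma reflect_finset_sum {ι : Type*} (N : ℕ) (s : Finset ι) (f : ι → ℤ[X]) :
    reflect N (∑ i ∈ s, f i) = ∑ i ∈ s, reflect N (f i) := by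
  ext i
  simp [coeff_reflect]

lemma reflect_one_add_X_pow (N : ℕ) : reflect N ((1 + X : ℤ[X]) ^ N) = (1 + X) ^ N := by
  ext i
  rw [coeff_reflect, coeff_one_add_X_pow, coeff_one_add_X_pow]
  rcases le_or_gt i N with h | h
  · rw [revAt_le h, Nat.choose_symm h]
  · rw [revAt_eq_self_of_lt h]

lemma natDegree_one_add_X_pow_le (N : ℕ) : ((1 + X : ℤ[X]) ^ N).natDegree ≤ N := by
  refine natDegree_pow_le_of_le (m := 1) N ?_ |>.trans (by simp)
  compute_degree

lemma reflect_uniformZ (d m : ℕ) : reflect d (uniformZ d m) = uniformZ d m := by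
  rw [uniformZ_eq, reflect_finset_sum]
  refine Finset.sum_congr rfl fun i hi => ?_
  have hi' : 2 * i ≤ d := by have := Finset.mem_range.1 hi; omega
  have h := reflect_mul (F := 2 * i) (G := d - 2 * i) (X ^ i : ℤ[X]) ((1 + X) ^ (d - 2 * i))
    (by rw [natDegree_X_pow]; omega) (natDegree_one_add_X_pow_le _)
  rw [show 2 * i + (d - 2 * i) = d by omega, reflect_one_add_X_pow, reflect_monomial,
    revAt_le (by omega), show 2 * i - i = i by omega] at h
  rw [mul_assoc, reflect_C_mul, h]

lemma natDegree_uniformKL_le (d m : ℕ) : (uniformKL d m).natDegree ≤ d :=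
  natDegree_le_iff_coeff_eq_zero.2 fun _ h => uniformKL_coeff_of_le _ _ _ h.le

lemma reflect_binTransform_uniformKL (d m : ℕ) :
    reflect d (binTransform m X (fun e => uniformKL e m) d) =
      binTransform m 1 (fun e => reflect e (uniformKL e m)) d := by
  simp only [binTransform, reflect_finset_sum]
  refine Finset.sum_congr rfl fun j hj => ?_
  have hj' := Finset.mem_range.1 hj
  have h := reflect_mul (F := j) (G := d - j) (X ^ j : ℤ[X]) (uniformKL (d - j) m)
    (by simp) (natDegree_uniformKL_le _ _)
  rw [show j + (d - j) = d by omega, reflect_monomial, revAt_le le_rfl, Nat.sub_self, pow_zero] at h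
  rw [mul_assoc, ← C_eq_natCast, reflect_C_mul, h]
  simp

/-- The characteristic polynomial of the uniform matroid of rank `d` and corank `m`,
for positive `d`. -/
noncomputable def uniformChar (d m : ℕ) : ℤ[X] := binTransform m (-1) (fun e => X ^ e - 1) d

/-- Palindromicity of Z equates the transform for `1` of the reflected polynomials with `X ^ e - 1`
plus the transform for `X`; the transform for `-1` is then applied to both sides. -/
lemma reflect_uniformKL {d : ℕ} (hd : 0 < d) (m : ℕ) :
    reflect d (uniformKL d m) = uniformChar d m +
      binTransform m (X - 1) (fun e => uniformKL e m) d := by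
  have h : ∀ e, 0 < e → e ≤ d → binTransform m 1 (fun e => reflect e (uniformKL e m)) e =
      (X ^ e - 1) + binTransform m X (fun e => uniformKL e m) e := by
    intro e _ _
    have := reflect_uniformZ e m
    rw [uniformZ, reflect_add, reflect_binTransform_uniformKL, reflect_monomial, revAt_le le_rfl,
      Nat.sub_self, pow_zero] at this
    linear_combination this
  rw [sub_eq_neg_add, ← binTransform_binTransform, uniformChar, ← binTransform_add,
    ← binTransform_congr h, binTransform_binTransform, neg_add_cancel, binTransform_zero _ _ hd]

/-! ### Closed form of the γ-coefficients. -/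

lemma sum_sub_mul_choose (q a : ℕ) :
    ∑ l ∈ Finset.range a, ((a : ℤ) - l) * ((q + l).choose l : ℤ) = (q + a + 1).choose (q + 2) := by
  have hs : ∀ a, ∑ l ∈ Finset.range a, ((q + l).choose l : ℤ) = (q + a).choose (q + 1) := by
    intro a
    induction a with
    | zero => simp
    | succ a ih =>
      rw [Finset.sum_range_succ, ih, ← add_assoc q a 1, Nat.choose_succ_succ',
        Nat.choose_symm_add (a := q) (b := a)]
      push_cast
      ring
  induction a with
  | zero => simp
  | succ a ih =>
    have h1 : ∀ l ∈ Finset.range (a + 1), (((a + 1 : ℕ) : ℤ) - l) * ((q + l).choose l : ℤ) =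
        ((a : ℤ) - l) * ((q + l).choose l : ℤ) + ((q + l).choose l : ℤ) := by
      intro l _
      push_cast
      ring
    rw [Finset.sum_congr rfl h1, Finset.sum_add_distrib, hs, Finset.sum_range_succ, ih,
      show q + (a + 1) + 1 = q + a + 1 + 1 by omega, Nat.choose_succ_succ' (q + a + 1)]
    push_cast
    ring_nf

/-- Rewrites the increment of `uniformGamma` in `m` so that the factor `a.choose (p + 1)` of the
closed form, free of `m`, splits off. -/
lemma choose_mul_klTop_eq (a p m : ℕ) :
    (a : ℤ) * ((a + p + 1 + m).choose (m + 2 * p + 2) * klTop p m) =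
      a.choose (p + 1) * ((m + p).choose p * (a + p + 1 + m).choose (m + p + 2)) := by
  cases a with
  | zero => simp
  | succ a =>
    have hp : ((p : ℤ) + 1) ≠ 0 := by positivity
    refine mul_left_cancel₀ hp ?_
    have h1 := succ_mul_klTop p m
    have h2 := Nat.choose_mul (n := a + 1 + p + 1 + m) (k := m + p + 2 + p) (s := m + p + 2)
      (by omega)
    have h3 := Nat.add_one_mul_choose_eq a p
    rw [Nat.choose_symm_add, show a + 1 + p + 1 + m - (m + p + 2) = a by omega,
      show m + p + 2 + p - (m + p + 2) = p by omega, show m + p + 2 + p = 2 * p + m + 2 by omega] at h2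
    rw [show m + 2 * p + 2 = 2 * p + m + 2 by omega, add_comm m p]
    zify at h2 h3
    push_cast
    rw [show p + m + 2 = m + p + 2 by omega]
    linear_combination (((a : ℤ) + 1) * ((a + 1 + p + 1 + m).choose (2 * p + m + 2) : ℤ)) * h1 +
      (((a : ℤ) + 1) * ((p + m).choose p : ℤ)) * h2 +
      ((p + m).choose p * (a + 1 + p + 1 + m).choose (m + p + 2) : ℤ) * h3

/-- Both sides have the same increment in `m`: Pascal's rule and trinomial revision reduce that of
the right side to `sum_sub_mul_choose`. -/
lemma mul_uniformGamma (a p m : ℕ) :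
    (a : ℤ) * uniformGamma (a + p + 1) m (p + 1) = a.choose (p + 1) *
      ∑ l ∈ Finset.range a, ((a : ℤ) - l) * ((p + l).choose p * (m + p + l).choose (p + l + 1)) := by
  induction m with
  | zero =>
    rw [Finset.sum_eq_zero]
    · simp [uniformGamma]
    · intro l _
      rw [Nat.choose_eq_zero_of_lt (n := 0 + p + l) (by omega)]
      simp
  | succ m ih =>
    have h : ∀ l ∈ Finset.range a,
        ((a : ℤ) - l) * ((p + l).choose p * (m + 1 + p + l).choose (p + l + 1)) =
        ((a : ℤ) - l) * ((p + l).choose p * (m + p + l).choose (p + l + 1)) +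
        (m + p).choose p * (((a : ℤ) - l) * (m + p + l).choose l) := by
      intro l _
      have e1 := Nat.choose_mul (n := m + p + l) (k := p + l) (s := l) (by omega)
      rw [← Nat.choose_symm_add (a := p) (b := l), show m + p + l - l = m + p by omega,
        show p + l - l = p by omega] at e1
      rw [show m + 1 + p + l = m + p + l + 1 by omega, Nat.choose_succ_succ']
      zify at e1
      push_cast
      linear_combination ((a : ℤ) - l) * e1
    rw [Finset.sum_congr rfl h, Finset.sum_add_distrib, ← Finset.mul_sum, sum_sub_mul_choose,
      mul_add, ← ih, show m + p + a + 1 = a + p + 1 + m by omega, ← choose_mul_klTop_eq,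
      uniformGamma, Finset.sum_range_succ, mul_add]
    rfl

lemma uniformGamma_eq (k n i : ℕ) (hi : 0 < i) (hik : i < k) :
    (uniformGamma k (n - k) i : ℚ) =
        1 / ((k : ℚ) - i) * ((k - i).choose i : ℚ) *
          ∑ j ∈ Finset.Icc i (k - 1),
            ((k : ℚ) - j) * ((j - 1).choose (i - 1) : ℚ) * ((n - k + j - 1).choose j : ℚ) := by
  obtain ⟨p, rfl⟩ : ∃ p, i = p + 1 := ⟨i - 1, by omega⟩
  obtain ⟨a, rfl⟩ : ∃ a, k = a + p + 1 := ⟨k - (p + 1), by omega⟩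
  have h := congrArg (Int.cast (R := ℚ)) (mul_uniformGamma a p (n - (a + p + 1)))
  have ha : (a : ℚ) ≠ 0 := by
    have : 0 < a := by omega
    positivity
  have hk : ((a + p + 1 : ℕ) : ℚ) - ((p + 1 : ℕ) : ℚ) = a := by push_cast; ring
  have hI : Finset.Icc (p + 1) (a + p + 1 - 1) = Finset.Ico (p + 1) (a + p + 1) := by
    ext j
    simp only [Finset.mem_Icc, Finset.mem_Ico]
    omega
  rw [hk, show a + p + 1 - (p + 1) = a by omega, hI, Finset.sum_Ico_eq_sum_range,
    show a + p + 1 - (p + 1) = a by omega]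
  have hs : ∀ l ∈ Finset.range a, (((a + p + 1 : ℕ) : ℚ) - ((p + 1 + l : ℕ) : ℚ)) *
      ((p + 1 + l - 1).choose (p + 1 - 1) : ℚ) *
      ((n - (a + p + 1) + (p + 1 + l) - 1).choose (p + 1 + l) : ℚ) =
      ((a : ℚ) - l) * ((p + l).choose p * (n - (a + p + 1) + p + l).choose (p + l + 1)) := by
    intro l _
    rw [show p + 1 + l - 1 = p + l by omega, show p + 1 + l = p + l + 1 by omega,
      show n - (a + p + 1) + (p + l + 1) - 1 = n - (a + p + 1) + p + l by omega,
      show p + 1 - 1 = p by omega]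
    push_cast
    ring
  rw [Finset.sum_congr rfl hs]
  push_cast at h
  rw [one_div, mul_assoc, ← h, inv_mul_cancel_left₀ ha]

end Uniform
end Matroid

namespace Matroid

/-! ### Flats and invariants of uniform matroids. -/

section Uniform

variable {α : Type*}

/-- `M` is a uniform matroid of rank `d` and corank `m` on its ground set. -/
structure IsUniform (M : Matroid α) (d m : ℕ) : Prop where
  ncard_ground : M.E.ncard = d + m
  indep_iff : ∀ I ⊆ M.E, M.Indep I ↔ I.ncard ≤ d

namespace IsUniform

variable {M : Matroid α} {d m : ℕ}

lemma rkSet_eq_ncard (h : M.IsUniform d m) {F : Set α} (hFE : F ⊆ M.E) (hF : F.ncard ≤ d) :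
    M.rkSet F = F.ncard := by
  rw [rkSet, ((h.indep_iff F hFE).2 hF).eRk_eq_encard]
  rfl

variable [Finite α]

/-- Any `d` elements span, while a smaller set stays independent when any element is added. -/
lemma isFlat_iff (h : M.IsUniform d m) {F : Set α} :
    M.IsFlat F ↔ F ⊆ M.E ∧ F.ncard < d ∨ F = M.E := by
  constructor
  · intro hF
    by_contra! hc
    have hd := hc.1 hF.subset_ground
    obtain ⟨e, heE, heF⟩ := Set.exists_of_ssubset (hF.subset_ground.ssubset_of_ne hc.2)
    obtain ⟨J, hJF, hJ⟩ := Set.exists_subset_card_eq hd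
    have hJE := hJF.trans hF.subset_ground
    have hJi : M.Indep J := (h.indep_iff J hJE).2 hJ.le
    have heJ : e ∉ J := fun hh => heF (hJF hh)
    have : e ∈ M.closure J := by
      by_contra hn
      have := (hJi.notMem_closure_iff_of_notMem heJ heE).1 hn
      rw [h.indep_iff _ (Set.insert_subset heE hJE),
        Set.ncard_insert_of_notMem heJ (Set.toFinite _)] at this
      omega
    exact heF (hF.closure ▸ M.closure_subset_closure hJF this)
  · rintro (⟨hFE, hF⟩ | rfl)
    · have hFi : M.Indep F := (h.indep_iff F hFE).2 hF.le
      rw [isFlat_iff_closure_eq]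
      refine (M.subset_closure F hFE).antisymm' fun e he => ?_
      by_contra heF
      have heE := M.closure_subset_ground F he
      refine (hFi.notMem_closure_iff_of_notMem heF heE).2 ?_ he
      rw [h.indep_iff _ (Set.insert_subset heE hFE),
        Set.ncard_insert_of_notMem heF (Set.toFinite _)]
      omega
    · exact M.ground_isFlat

lemma rkTop_eq (h : M.IsUniform d m) : M.rkTop = d := by
  obtain ⟨J, hJE, hJ⟩ := Set.exists_subset_card_eq (s := M.E) (n := d) (by rw [h.ncard_ground]; omega)
  have hJi : M.Indep J := (h.indep_iff J hJE).2 hJ.le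
  have he : M.eRk M.E = d := by
    refine le_antisymm (eRk_le_iff.2 fun I hI hIi => ?_) ?_
    · rw [← Set.Finite.cast_ncard_eq (Set.toFinite I)]
      exact_mod_cast (h.indep_iff I hI).1 hIi
    · rw [← hJ, Set.Finite.cast_ncard_eq (Set.toFinite J)]
      exact hJi.encard_le_eRk_of_subset hJE
  simp [rkTop, rkSet, he]

lemma restrict (h : M.IsUniform d m) {F : Set α} (hFE : F ⊆ M.E) (hF : F.ncard ≤ d) :
    (M ↾ F).IsUniform F.ncard 0 where
  ncard_ground := rfl
  indep_iff I hI := by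
    have hI' : I ⊆ F := hI
    have := Set.ncard_le_ncard hI' (Set.toFinite _)
    rw [restrict_indep_iff, h.indep_iff I (hI'.trans hFE)]
    exact ⟨fun _ => this, fun _ => ⟨this.trans hF, hI'⟩⟩

lemma contract (h : M.IsUniform d m) {F : Set α} (hFE : F ⊆ M.E) (hF : F.ncard ≤ d) :
    (M ／ F).IsUniform (d - F.ncard) m where
  ncard_ground := by
    rw [contract_ground, Set.ncard_sdiff hFE (Set.toFinite _), h.ncard_ground]
    omega
  indep_iff I hI := by
    obtain ⟨hIE, hIF⟩ := Set.subset_sdiff.1 hI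
    rw [((h.indep_iff F hFE).2 hF).contract_indep_iff, h.indep_iff _ (Set.union_subset hIE hFE),
      Set.ncard_union_eq hIF (Set.toFinite _) (Set.toFinite _)]
    constructor
    · rintro ⟨-, hh⟩
      omega
    · exact fun hh => ⟨hIF, by omega⟩

lemma sum_flats (h : M.IsUniform d m) {A : Type*} [AddCommMonoid A] (f : Flats M → A) (g : ℕ → A)
    (hfg : ∀ F : Flats M, F.1 ⊆ M.E → F.1.ncard < d → f F = g F.1.ncard) :
    ∑ F : Flats M, f F =
      ∑ j ∈ Finset.range d, (m + d).choose j • g j + f ⟨M.E, M.ground_isFlat⟩ := by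
  classical
  have := Fintype.ofFinite α
  have h1 : ∀ F : Flats M, f F = (fun F : Set α =>
      if F.ncard < d then g F.ncard else f ⟨M.E, M.ground_isFlat⟩) F.1 := by
    intro F
    by_cases hF : F.1.ncard < d
    · simp [hF, hfg F F.2.subset_ground hF]
    · simp only [hF, if_false]
      congr
      exact Subtype.ext ((h.isFlat_iff.1 F.2).resolve_left fun hh => hF hh.2)
  have hE : ¬ M.E.ncard < d := by rw [h.ncard_ground]; omega
  rw [Finset.sum_congr rfl fun F _ => h1 F, ← Finset.sum_subtype
    (insert M.E (Finset.univ.filter fun F : Set α => F ⊆ M.E ∧ F.ncard < d))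
    (by intro F; simp [h.isFlat_iff, or_comm]) (fun F : Set α =>
      if F.ncard < d then g F.ncard else f ⟨M.E, M.ground_isFlat⟩),
    Finset.sum_insert (by simp [hE]), if_neg hE, add_comm]
  congr 1
  rw [← Finset.sum_fiberwise_of_maps_to (t := Finset.range d) (g := Set.ncard) (by simp)]
  refine Finset.sum_congr rfl fun j hj => ?_
  have hj' := Finset.mem_range.1 hj
  have hc : (Finset.univ.filter fun F : Set α => F ⊆ M.E ∧ F.ncard < d).filter
      (fun F => F.ncard = j) =
      (M.E.toFinset.powersetCard j).map ⟨(↑), Finset.coe_injective⟩ := by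
    ext F
    simp only [Finset.mem_filter, Finset.mem_univ, true_and, Finset.mem_map,
      Finset.mem_powersetCard, Function.Embedding.coeFn_mk]
    constructor
    · rintro ⟨⟨hF, -⟩, rfl⟩
      exact ⟨F.toFinset, ⟨by simpa using hF, (Set.ncard_eq_toFinset_card' F).symm⟩, by simp⟩
    · rintro ⟨F, ⟨hF, rfl⟩, rfl⟩
      rw [Set.ncard_coe_finset]
      exact ⟨⟨by simpa using hF, hj'⟩, rfl⟩
  rw [Finset.sum_congr rfl (g := fun _ => g j), Finset.sum_const, hc, Finset.card_map,
    Finset.card_powersetCard, ← Set.ncard_eq_toFinset_card', h.ncard_ground, add_comm d m]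
  intro F hF
  simp only [Finset.mem_filter] at hF
  rw [if_pos hF.1.2.2, hF.2]

lemma botFlat_eq (h : M.IsUniform d m) (hd : 0 < d) : M.botFlat.1 = ∅ :=
  IsFlat.closure (h.isFlat_iff.2 (Or.inl ⟨Set.empty_subset _, by simpa using hd⟩))

open Classical in
-- The interval below a proper flat is a Boolean lattice.
lemma mu_eq (h : M.IsUniform d m) (F : Flats M) (hF : F.1.ncard < d) :
    IncidenceAlgebra.mu ℤ M.botFlat F = (-1) ^ F.1.ncard := by
  have := Fintype.ofFinite α
  have hd : 0 < d := by omega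
  induction hn : F.1.ncard using Nat.strong_induction_on generalizing F with
  | _ n ih =>
  subst hn
  by_cases hb : M.botFlat = F
  · subst hb
    simp [h.botFlat_eq hd]
  have hne : F.1 ≠ ∅ := fun hh => hb (Subtype.ext ((h.botFlat_eq hd).trans hh.symm))
  have hbF : M.botFlat ≤ F := by
    change M.botFlat.1 ⊆ F.1
    simp [h.botFlat_eq hd]
  have hlt : ∀ G ∈ Finset.Ico M.botFlat F,
      IncidenceAlgebra.mu ℤ M.botFlat G = (-1) ^ G.1.ncard := by
    intro G hG
    have hGF : G.1 ⊂ F.1 := (Finset.mem_Ico.1 hG).2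
    have := Set.ncard_lt_ncard hGF (Set.toFinite _)
    exact ih _ this G (by omega) rfl
  have hs : ∑ G ∈ Finset.Icc M.botFlat F, (-1 : ℤ) ^ G.1.ncard = 0 := by
    rw [← Finset.sum_powerset_neg_one_pow_card_of_nonempty (x := F.1.toFinset)
      (by simpa using Set.nonempty_iff_ne_empty.2 hne)]
    refine Finset.sum_bij' (fun G _ => G.1.toFinset) (fun S hS => ⟨(S : Set α), ?_⟩)
      ?_ ?_ ?_ ?_ ?_
    · have hS' : (S : Set α) ⊆ F.1 := by simpa using hS
      have := Set.ncard_le_ncard hS' (Set.toFinite _)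
      exact h.isFlat_iff.2 (Or.inl ⟨hS'.trans F.2.subset_ground, by omega⟩)
    · intro G hG
      have : G.1 ⊆ F.1 := (Finset.mem_Icc.1 hG).2
      simpa using this
    · intro S hS
      have hS' : (S : Set α) ⊆ F.1 := by simpa using hS
      refine Finset.mem_Icc.2 ⟨?_, hS'⟩
      change M.botFlat.1 ⊆ _
      simp [h.botFlat_eq hd]
    · intro G _
      simp
    · intro S _
      simp
    · intro G _
      rw [Set.ncard_eq_toFinset_card']
  rw [IncidenceAlgebra.mu_eq_neg_sum_Ico_of_ne hb, Finset.sum_congr rfl hlt]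
  rw [← Finset.Ico_insert_right hbF, Finset.sum_insert (by simp)] at hs
  linear_combination -hs

open Classical in
lemma mu_ground_eq (h : M.IsUniform d m) (hd : 0 < d) :
    IncidenceAlgebra.mu ℤ M.botFlat ⟨M.E, M.ground_isFlat⟩ =
      -∑ j ∈ Finset.range d, ((m + d).choose j : ℤ) * (-1) ^ j := by
  have hs := h.sum_flats (fun F => IncidenceAlgebra.mu ℤ M.botFlat F) (fun j => (-1) ^ j)
    fun F _ hF => h.mu_eq F hF
  have hI : Finset.Icc M.botFlat ⟨M.E, M.ground_isFlat⟩ = Finset.univ := by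
    ext F
    simp only [Finset.mem_Icc, Finset.mem_univ, iff_true]
    refine ⟨?_, F.2.subset_ground⟩
    change M.botFlat.1 ⊆ _
    simp [h.botFlat_eq hd]
  have hne : M.botFlat ≠ ⟨M.E, M.ground_isFlat⟩ := by
    intro hh
    have h1 : M.botFlat.1 = M.E := congrArg Subtype.val hh
    have h2 := h.ncard_ground
    rw [← h1, h.botFlat_eq hd, Set.ncard_empty] at h2
    omega
  rw [← hI, IncidenceAlgebra.sum_Icc_mu_right, if_neg hne] at hs
  simp only [nsmul_eq_mul] at hs
  linear_combination -hs

lemma loopless (h : M.IsUniform d m) (hd : 0 < d) : M.Loopless :=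
  ⟨h.botFlat_eq hd⟩

lemma charPoly_eq (h : M.IsUniform d m) (hd : 0 < d) : charPoly M = uniformChar d m := by
  classical
  rw [charPoly, if_pos (h.loopless hd), h.sum_flats _ (fun j => C ((-1) ^ j) * X ^ (d - j))]
  · rw [show M.rkTop - M.rkSet M.E = 0 from Nat.sub_self _, h.mu_ground_eq hd, pow_zero, mul_one,
      uniformChar, binTransform, C_neg, map_sum, ← sub_eq_add_neg, ← Finset.sum_sub_distrib]
    refine Finset.sum_congr rfl fun j _ => ?_
    simp only [nsmul_eq_mul, map_mul, map_natCast, map_pow, map_neg, map_one]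
    ring
  · intro F hFE hF
    rw [h.mu_eq F hF, h.rkTop_eq, h.rkSet_eq_ncard hFE hF.le]

lemma charPoly_boolean (h : M.IsUniform d 0) : charPoly M = (X - 1) ^ d := by
  -- In rank 0 the transform is an empty sum, whereas the characteristic polynomial is 1.
  rcases Nat.eq_zero_or_pos d with rfl | hd
  · classical
    have hE : M.E = ∅ := (Set.ncard_eq_zero (Set.toFinite _)).1 h.ncard_ground
    have hb : M.botFlat = ⟨M.E, M.ground_isFlat⟩ :=
      Subtype.ext ((M.closure_subset_ground ∅).antisymm (by simp [hE]))
    have hl : M.Loopless := ⟨Set.subset_empty_iff.1 ((M.closure_subset_ground ∅).trans hE.subset)⟩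
    rw [charPoly, if_pos hl, h.sum_flats _ (fun _ => 0) (by simp)]
    simp [hb, rkTop]
  · rw [h.charPoly_eq hd, uniformChar, binTransform_neg_one_boolean _ hd]

lemma klPoly_of_ground_eq_empty (hE : M.E = ∅) : klPoly M = 1 := by
  have : M.rkTop = 0 := by simp [rkTop, rkSet, hE]
  rw [klPoly, if_pos this, if_pos hE]

/-- By induction on the rank, the sum over non-empty flats is `reflect d P - P`: the empty flat is
the term `j = 0` of `reflect_uniformKL`. As `P` has degree below `d / 2`, the upper coefficients of
this difference are those of `P` in reverse. -/
lemma klPoly_eq (h : M.IsUniform d m) (hd : 0 < d) : klPoly M = uniformKL d m := by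
  classical
  induction d using Nat.strong_induction_on generalizing M with
  | _ d ih =>
  have hsum : (∑ F : {F : Flats M // F.1 ≠ ∅}, charPoly (M ↾ F.1.1) * klPoly (M ／ F.1.1)) =
      reflect d (uniformKL d m) - uniformKL d m := by
    have h1 : (∑ F : {F : Flats M // F.1 ≠ ∅}, charPoly (M ↾ F.1.1) * klPoly (M ／ F.1.1)) =
        ∑ F : Flats M, if F.1 ≠ ∅ then charPoly (M ↾ F.1) * klPoly (M ／ F.1) else 0 := by
      rw [← Finset.sum_filter]
      exact (Finset.sum_subtype _ (by simp) fun F : Flats M =>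
        charPoly (M ↾ F.1) * klPoly (M ／ F.1)).symm
    have hne : M.E ≠ ∅ := by
      intro hE
      have := h.ncard_ground
      rw [hE, Set.ncard_empty] at this
      omega
    rw [h1, h.sum_flats _ (fun j => if j ≠ 0 then (X - 1) ^ j * uniformKL (d - j) m else 0)]
    · rw [if_pos hne, restrict_ground_eq_self, h.charPoly_eq hd,
        klPoly_of_ground_eq_empty (M := M ／ M.E) (by simp), reflect_uniformKL hd, binTransform]
      obtain ⟨d, rfl⟩ : ∃ e, d = e + 1 := ⟨d - 1, by omega⟩
      rw [Finset.sum_range_succ', Finset.sum_range_succ' _ d]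
      simp [mul_assoc]
      ring
    · intro F hFE hF
      by_cases hF0 : F.1 = ∅
      · simp [hF0]
      have hpos : 0 < F.1.ncard :=
        (Set.ncard_pos (Set.toFinite _)).2 (Set.nonempty_iff_ne_empty.2 hF0)
      rw [if_pos hF0, if_pos hpos.ne', (h.restrict hFE hF.le).charPoly_boolean,
        ih _ (by omega) (h.contract hFE hF.le) (by omega)]
  rw [klPoly, if_neg (by rw [h.rkTop_eq]; omega), hsum, h.rkTop_eq]
  ext i
  simp only [finsetSum_coeff, coeff_C_mul, coeff_X_pow, mul_ite, mul_one, mul_zero,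
    Finset.sum_ite_eq, Finset.mem_range]
  split_ifs with hi
  · rw [coeff_sub, coeff_reflect, revAt_le (by omega), uniformKL_coeff_eq_zero (i := d - i) (by omega),
      sub_zero, show d - (d - i) = i by omega]
  · rw [uniformKL_coeff_eq_zero (by omega)]

lemma zPoly_eq (h : M.IsUniform d m) : zPoly M = uniformZ d m := by
  rw [zPoly, h.sum_flats _ (fun j => X ^ j * uniformKL (d - j) m)]
  · rw [show M.rkSet M.E = d from h.rkTop_eq, klPoly_of_ground_eq_empty (M := M ／ M.E) (by simp),
      mul_one, uniformZ, add_comm]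
    simp [binTransform, mul_assoc]
  · intro F hFE hF
    rw [h.rkSet_eq_ncard hFE hF.le, (h.contract hFE hF.le).klPoly_eq (by omega)]

end IsUniform

lemma uniform_isUniform {k n : ℕ} (hkn : k ≤ n) : (uniform k n).IsUniform k (n - k) where
  ncard_ground := by
    change (Set.univ : Set (Fin n)).ncard = _
    rw [Set.ncard_univ, Nat.card_fin]
    omega
  indep_iff _ _ := Iff.rfl

end Uniform

/-! ### Uniqueness of γ-expansions and conclusion. -/

/-- The system is unitriangular, since `X ^ l * (1 + X) ^ (d - 2 * l)` starts with `X ^ l`; hence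
uniqueness. -/
lemma coeff_sum_gamma (a : ℕ → ℤ) {d i : ℕ} (hi : i ≤ d / 2) :
    (∑ l ∈ Finset.range (d / 2 + 1), C (a l) * X ^ l * (1 + X : ℤ[X]) ^ (d - 2 * l)).coeff i =
      a i + ∑ l ∈ Finset.range i, a l * ((d - 2 * l).choose (i - l) : ℤ) := by
  have h : ∀ l, (C (a l) * X ^ l * (1 + X : ℤ[X]) ^ (d - 2 * l)).coeff i =
      if l ≤ i then a l * ((d - 2 * l).choose (i - l) : ℤ) else 0 := by
    intro l
    rw [mul_assoc, coeff_C_mul, coeff_X_pow_mul', coeff_one_add_X_pow]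
    split_ifs <;> simp
  simp only [finsetSum_coeff, h]
  rw [← Finset.sum_filter, show (Finset.range (d / 2 + 1)).filter (· ≤ i) = Finset.range (i + 1) by
    ext; simp; omega, Finset.sum_range_succ, add_comm]
  simp

lemma IsGammaExpansion.unique {f g g' : ℤ[X]} (hg : IsGammaExpansion f g)
    (hg' : IsGammaExpansion f g') : g = g' := by
  ext i
  induction i using Nat.strong_induction_on with
  | _ i ih =>
  rcases le_or_gt i (f.natDegree / 2) with hi | hi
  · have h := congrArg (fun p => p.coeff i) (hg.2.symm.trans hg'.2)
    simp only [coeff_sum_gamma _ hi] at h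
    rw [Finset.sum_congr rfl fun l hl => by rw [ih l (Finset.mem_range.1 hl)]] at h
    exact add_right_cancel h
  · rw [coeff_eq_zero_of_natDegree_lt (hg.1.trans_lt hi),
      coeff_eq_zero_of_natDegree_lt (hg'.1.trans_lt hi)]

lemma IsGammaExpansion.gammaOf_eq {f g : ℤ[X]} (hg : IsGammaExpansion f g) : gammaOf f = g := by
  have h : ∃ g, IsGammaExpansion f g := ⟨g, hg⟩
  rw [gammaOf, dif_pos h]
  exact h.choose_spec.unique hg

section Uniform

lemma natDegree_uniformZ (d m : ℕ) : (uniformZ d m).natDegree = d := by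
  refine natDegree_eq_of_le_of_coeff_ne_zero ?_ ?_
  · rw [uniformZ_eq]
    refine natDegree_sum_le_of_forall_le _ _ fun i hi => ?_
    have := Finset.mem_range.1 hi
    refine (natDegree_mul_le_of_le (natDegree_C_mul_X_pow_le _ _)
      (natDegree_one_add_X_pow_le _)).trans (by omega)
  -- By palindromicity the top coefficient is the constant one, `uniformGamma d m 0 = 1`.
  · have h : (uniformZ d m).coeff d = (uniformZ d m).coeff 0 := by
      conv_lhs => rw [← reflect_uniformZ, coeff_reflect, revAt_le le_rfl, Nat.sub_self]
    rw [h, uniformZ_eq, coeff_sum_gamma _ (Nat.zero_le _)]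
    simp [uniformGamma]

/-- The polynomial with coefficients `uniformGamma d m`. -/
noncomputable def uniformGammaPoly (d m : ℕ) : ℤ[X] :=
  ∑ i ∈ Finset.range (d / 2 + 1), C (uniformGamma d m i) * X ^ i

lemma coeff_uniformGammaPoly (d m i : ℕ) : (uniformGammaPoly d m).coeff i = uniformGamma d m i := by
  simp only [uniformGammaPoly, finsetSum_coeff, coeff_C_mul, coeff_X_pow, mul_ite, mul_one,
    mul_zero, Finset.sum_ite_eq, Finset.mem_range]
  split_ifs with h
  · rfl
  · rw [uniformGamma_eq_zero (by omega)]

lemma isGammaExpansion_uniformZ (d m : ℕ) :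
    IsGammaExpansion (uniformZ d m) (uniformGammaPoly d m) := by
  rw [IsGammaExpansion, natDegree_uniformZ]
  simp only [coeff_uniformGammaPoly]
  refine ⟨natDegree_le_iff_coeff_eq_zero.2 fun i hi => ?_, uniformZ_eq d m⟩
  rw [coeff_uniformGammaPoly, uniformGamma_eq_zero (by omega)]

lemma gammaPoly_uniform {k n : ℕ} (hkn : k ≤ n) :
    (uniform k n).gammaPoly = uniformGammaPoly k (n - k) := by
  rw [gammaPoly, (uniform_isUniform hkn).zPoly_eq, (isGammaExpansion_uniformZ _ _).gammaOf_eq]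

end Uniform
end Matroid

theorem mainTheorem9 (k n : ℕ) (hkn : k ≤ n) :
    (Matroid.uniform k n).IsGammaPositive ∧
    (Matroid.uniform k n).gammaPoly.natDegree ≤ k / 2 ∧
    (Matroid.uniform k n).gammaPoly.coeff 0 = 1 ∧
    ∀ i : ℕ, 0 < i → i < k →
      ((Matroid.uniform k n).gammaPoly.coeff i : ℚ) =
        1 / ((k : ℚ) - i) * ((k - i).choose i : ℚ) *
          ∑ j ∈ Finset.Icc i (k - 1),
            ((k : ℚ) - j) * ((j - 1).choose (i - 1) : ℚ) * ((n - k + j - 1).choose j : ℚ) := by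
  have hdeg := (Matroid.isGammaExpansion_uniformZ k (n - k)).1
  rw [Matroid.natDegree_uniformZ] at hdeg
  simp only [Matroid.IsGammaPositive, Matroid.gammaPoly_uniform hkn,
    Matroid.coeff_uniformGammaPoly]
  exact ⟨Matroid.uniformGamma_nonneg _ _, hdeg, rfl, Matroid.uniformGamma_eq k n⟩
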